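/- Let $K$ be a Stonean space, that is, a compact Hausdorff space in which the closure of every open set is open, let $C(K)$ be the Banach space of continuous complex-valued functions on $K$ with the supremum norm, let $X$ be a complex Banach space, and write $S(\cdot)$ for unit spheres and $\mathcal{B}_X$ for the closed unit ball of $X$. Let $\Delta : S(C(K))\to S(X)$ be a surjective isometry. Then there is exactly one clopen set $K_1\subseteq K$ such that, with $K_2 := K\setminus K_1$, $$\Delta(\lambda\chi_{K_1})=\lambda\,\Delta(\chi_{K_1}),\qquad \Delta(\lambda\chi_{K_2})=\overline{\lambda}\,\Delta(\chi_{K_2})\qquad\text{for all }\lambda\in\mathbb{C},\ |\lambda|=1$$ (the condition on $K_j$ being void if $K_j=\emptyset$). For each $t_0\in K$ put $A(t_0,1):=\{f\in S(C(K)) : f(t_0)=1\}$ and $$\operatorname{supp}(t_0,1):=\{\varphi\in X^* : \|\varphi\|=1,\ \varphi^{-1}(\{1\})\cap\mathcal{B}_X=\Delta(A(t_0,1))\}.$$ Then for each $t_0\in K$ the set $\operatorname{supp}(t_0,1)$ is non-empty, and for each $\varphi\in\operatorname{supp}(t_0,1)$ and every $a\in S(C(K))$, $$\varphi(\Delta(a))=\begin{cases}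 a(t_0) & \text{if } t_0\in K_1,\\ \overline{a(t_0)} & \text{if } t_0\in K_2.\end{cases}$$ Consequently, $\Delta$ extends to a surjective real linear isometry from $C(K)$ onto $X$. -/

import Mathlib

open scoped ComplexConjugate

namespace TingleyCK

open Metric TopologicalSpace

variable {K : Type*} [TopologicalSpace K] [CompactSpace K]
variable {X : Type*} [NormedAddCommGroup X] [NormedSpace ℂ X]

/-- The characteristic function of a clopen set, as an element of `C(K)`. -/
noncomputable def chi (U : Clopens K) : C(K, ℂ) :=
  (LocallyConstant.charFn ℂ U.isClopen).toContinuousMap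

/-- `A(t₀, γ)`: the functions in the unit sphere of `C(K)` that take the value `γ` at `t₀`. -/
def face (t₀ : K) (γ : ℂ) : Set (sphere (0 : C(K, ℂ)) 1) :=
  {f | (f : C(K, ℂ)) t₀ = γ}

/-- `supp(t₀, γ)`: the norm-one functionals `φ` on `X` for which the set of points of the closed
unit ball of `X` where `φ` takes the value `1` is exactly `Δ(A(t₀, γ))`. -/
def supp (Δ : sphere (0 : C(K, ℂ)) 1 → sphere (0 : X) 1) (t₀ : K) (γ : ℂ) :
    Set (StrongDual ℂ X) :=
  {φ | ‖φ‖ = 1 ∧ φ ⁻¹' {1} ∩ closedBall (0 : X) 1 = (fun f => (Δ f : X)) '' face t₀ γ}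

/-- The clopen set `K₁` satisfies `Δ(γ χ_{K₁}) = γ Δ(χ_{K₁})` and
`Δ(γ χ_{K \ K₁}) = conj γ Δ(χ_{K \ K₁})` for all `γ` of modulus one. The functions are quantified
as points `e`, `f` of the sphere, so that a condition about the empty set (whose characteristic
function is `0`, not in the sphere) is void. -/
structure IsLinearPart (Δ : sphere (0 : C(K, ℂ)) 1 → sphere (0 : X) 1) (K₁ : Clopens K) :
    Prop where
  linear : ∀ γ : ℂ, ‖γ‖ = 1 → ∀ e f : sphere (0 : C(K, ℂ)) 1,
    (e : C(K, ℂ)) = chi K₁ → (f : C(K, ℂ)) = γ • chi K₁ → (Δ f : X) = γ • (Δ e : X)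
  conjLinear : ∀ γ : ℂ, ‖γ‖ = 1 → ∀ e f : sphere (0 : C(K, ℂ)) 1,
    (e : C(K, ℂ)) = chi K₁ᶜ → (f : C(K, ℂ)) = γ • chi K₁ᶜ → (Δ f : X) = conj γ • (Δ e : X)

open Classical in
/-- `σ(t, a)`: equal to `a(t)` if `t ∈ K₁` and to the complex conjugate of `a(t)` if
`t ∈ K₂ = K \ K₁`. -/
noncomputable def sigma (K₁ : Clopens K) (t : K) (a : C(K, ℂ)) : ℂ :=
  if t ∈ K₁ then a t else conj (a t)

end TingleyCK

namespace TingleyCK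

open Metric TopologicalSpace

/-! ### Supporting functionals and isometries of spheres -/

section Support

variable {E X : Type*} [NormedAddCommGroup E] [NormedSpace ℂ E]
  [NormedAddCommGroup X] [NormedSpace ℂ X]

/-! Two unit vectors have a common supporting functional exactly when their sum has norm 2, that is,
when one is at distance 2 from the negative of the other. An isometry of spheres sees such
distances, so it carries sets with a common supporting functional to sets of the same kind
(`exists_support_image`). In C(K) every such set lies in a face {f : f q = μ}
(`exists_forall_apply_eq`), so the images of faces are maximal among supported sets, which yields
supp(p,1).

For φ in supp(p,1), the level sets of φ ∘ Δ over the unit circle are again faces at p, and matching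
the two families of levels gives an isometry of the circle fixing 1: the identity or conjugation.
Values of smaller modulus follow by comparing distances to two opposite faces (`apply_eq_or_conj`).
The function Δ⁻¹(iΔ(1)) takes only the values i and -i and shows which case holds at each point, so
K₁ is clopen. Gluing the functionals over K gives a real linear isometry X → C(K) that inverts Δ on
the sphere. -/

theorem eq_one_of_norm_le_one_of_one_le_re {z : ℂ} (hz : ‖z‖ ≤ 1) (h : 1 ≤ z.re) : z = 1 := by
  have h1 : z.re ^ 2 + z.im ^ 2 ≤ 1 := by
    have := Complex.sq_norm z
    rw [Complex.normSq_apply] at this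
    nlinarith [norm_nonneg z]
  have h2 : z.im = 0 := by nlinarith [sq_nonneg z.im]
  have h3 : z.re = 1 := by nlinarith [sq_nonneg z.im]
  exact Complex.ext (by simpa using h3) (by simpa using h2)

theorem eq_one_of_sum_eq_card {ι : Type*} (s : Finset ι) (a : ι → ℂ)
    (ha : ∀ i ∈ s, ‖a i‖ ≤ 1) (h : (s.card : ℝ) ≤ (∑ i ∈ s, a i).re) :
    ∀ i ∈ s, a i = 1 := by
  have hre : ∀ i ∈ s, (a i).re ≤ 1 := fun i hi => (Complex.re_le_norm _).trans (ha i hi)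
  have h1 : ∑ i ∈ s, (1 : ℝ) ≤ ∑ i ∈ s, (a i).re := by simpa using h
  have h2 : ∑ i ∈ s, (a i).re = ∑ i ∈ s, (1 : ℝ) := le_antisymm (Finset.sum_le_sum hre) h1
  intro i hi
  exact eq_one_of_norm_le_one_of_one_le_re (ha i hi)
    ((Finset.sum_eq_sum_iff_of_le hre).1 h2 i hi).ge

theorem norm_apply_le_one {φ : StrongDual ℂ X} (hφ : ‖φ‖ ≤ 1) {x : X} (hx : ‖x‖ ≤ 1) :
    ‖φ x‖ ≤ 1 :=
  (φ.le_opNorm_of_le hx).trans (by simpa using hφ)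

theorem one_le_norm_of_apply_eq_one {φ : StrongDual ℂ X} (hφ : ‖φ‖ ≤ 1) {x : X} (hx : φ x = 1) :
    1 ≤ ‖x‖ := by
  have := φ.le_of_opNorm_le hφ x
  simpa [hx] using this

theorem norm_add_eq_two_of_apply_eq_one {φ : StrongDual ℂ X} (hφ : ‖φ‖ ≤ 1) {x y : X}
    (hx : φ x = 1) (hy : φ y = 1) : 2 ≤ ‖x + y‖ := by
  have := φ.le_of_opNorm_le hφ (x + y)
  rw [map_add, hx, hy] at this
  norm_num at this
  exact this

theorem exists_support_of_two_le_norm_add {x y : X} (hx : ‖x‖ ≤ 1) (hy : ‖y‖ ≤ 1)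
    (h : 2 ≤ ‖x + y‖) : ∃ φ : StrongDual ℂ X, ‖φ‖ ≤ 1 ∧ φ x = 1 ∧ φ y = 1 := by
  obtain ⟨φ, hφ, hφxy⟩ := exists_dual_vector'' ℂ (x + y)
  have hx' := norm_apply_le_one hφ hx
  have hy' := norm_apply_le_one hφ hy
  have hre : (φ x).re + (φ y).re = ‖x + y‖ := by
    have := congrArg Complex.re hφxy
    simpa using this
  have hx1 := (Complex.re_le_norm _).trans hx'
  have hy1 := (Complex.re_le_norm _).trans hy'
  exact ⟨φ, hφ, eq_one_of_norm_le_one_of_one_le_re hx' (by linarith),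
    eq_one_of_norm_le_one_of_one_le_re hy' (by linarith)⟩

/-- The average of finitely many points of the unit sphere supported by a common functional. -/
theorem exists_average {ι : Type*} (s : Finset ι) (hs : s.Nonempty) (x : ι → X)
    (hx : ∀ i ∈ s, ‖x i‖ ≤ 1) {φ : StrongDual ℂ X} (hφ : ‖φ‖ ≤ 1) (h : ∀ i ∈ s, φ (x i) = 1) :
    ∃ w : sphere (0 : X) 1, φ w = 1 ∧
      ∀ χ : StrongDual ℂ X, ‖χ‖ ≤ 1 → χ w = 1 → ∀ i ∈ s, χ (x i) = 1 := by
  have hc : (s.card : ℂ) ≠ 0 := by exact_mod_cast hs.card_pos.ne'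
  have hc' : (0 : ℝ) < s.card := by exact_mod_cast hs.card_pos
  have hw : φ ((s.card : ℂ)⁻¹ • ∑ i ∈ s, x i) = 1 := by
    rw [map_smul, map_sum, Finset.sum_congr rfl h]
    simp [hc]
  refine ⟨⟨(s.card : ℂ)⁻¹ • ∑ i ∈ s, x i, ?_⟩, hw, ?_⟩
  · rw [mem_sphere_zero_iff_norm]
    refine le_antisymm ?_ (one_le_norm_of_apply_eq_one hφ hw)
    rw [norm_smul, norm_inv, Complex.norm_natCast, inv_mul_le_iff₀ hc', mul_one]
    exact (norm_sum_le _ _).trans ((Finset.sum_le_sum hx).trans (by simp))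
  · intro χ hχ hχw
    refine eq_one_of_sum_eq_card s (fun i => χ (x i)) (fun i hi => norm_apply_le_one hχ (hx i hi)) ?_
    rw [map_smul, map_sum, smul_eq_mul, inv_mul_eq_one₀ hc] at hχw
    rw [← hχw]
    simp

/-- Hahn–Banach separates the hull from the open unit ball. Dividing by the separating constant
leaves norm at most 1 and real part at least 1 on C, which forces the value 1. -/
theorem exists_support_of_convexHull {C : Set X} (hC : ∀ x ∈ C, ‖x‖ ≤ 1)
    (h : ∀ x ∈ convexHull ℝ C, 1 ≤ ‖x‖) :
    ∃ φ : StrongDual ℂ X, ‖φ‖ ≤ 1 ∧ ∀ x ∈ C, φ x = 1 := by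
  rcases C.eq_empty_or_nonempty with rfl | ⟨c, hc⟩
  · exact ⟨0, by simp, by simp⟩
  have hd : Disjoint (ball (0 : X) 1) (convexHull ℝ C) := by
    rw [Set.disjoint_left]
    intro x hx hx'
    rw [mem_ball_zero_iff] at hx
    linarith [h x hx']
  obtain ⟨f, u, hf, hfC⟩ := RCLike.geometric_hahn_banach_open (𝕜 := ℂ)
    (convex_ball (0 : X) 1) isOpen_ball (convex_convexHull ℝ C) hd
  have hu : 0 < u := by simpa using hf 0 (by simp)
  have hfn : ‖f‖ ≤ u := by
    refine f.opNorm_le_of_unit_norm (𝕜 := ℂ) hu.le ?_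
    intro x hx
    by_contra! hlt
    obtain ⟨c, hc1, hcx⟩ : ∃ c : ℂ, ‖c‖ = 1 ∧ c * f x = ‖f x‖ := by
      have h0 : f x ≠ 0 := by
        intro h0
        rw [h0, norm_zero] at hlt
        linarith
      refine ⟨‖f x‖ / f x, by simp [h0], by field_simp⟩
    have hfx : 0 < ‖f x‖ := hu.trans hlt
    -- After rotation and scaling this point lies in the open ball, yet `f` takes the value `u`
    -- there, against the strict separation.
    have hy : ‖((u / ‖f x‖ : ℝ) : ℂ) • (c • x)‖ < 1 := by
      rw [norm_smul, norm_smul, hc1, hx, Complex.norm_real, Real.norm_of_nonneg (by positivity)]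
      rw [mul_one, mul_one, div_lt_one hfx]
      exact hlt
    have := hf _ (mem_ball_zero_iff.2 hy)
    rw [map_smul f, map_smul f, smul_eq_mul, smul_eq_mul, hcx, ← Complex.ofReal_mul,
      div_mul_cancel₀ _ hfx.ne'] at this
    simp at this
  have hφ : ‖((u⁻¹ : ℝ) : ℂ) • f‖ ≤ 1 := by
    rw [norm_smul, Complex.norm_real, Real.norm_of_nonneg (by positivity), inv_mul_le_iff₀ hu]
    simpa using hfn
  refine ⟨((u⁻¹ : ℝ) : ℂ) • f, hφ, fun x hx => ?_⟩
  refine eq_one_of_norm_le_one_of_one_le_re (norm_apply_le_one hφ (hC x hx)) ?_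
  have := hfC x (subset_convexHull ℝ C hx)
  have h2 : (((u⁻¹ : ℝ) : ℂ) * f x).re = u⁻¹ * (f x).re := Complex.re_ofReal_mul _ _
  change 1 ≤ (((u⁻¹ : ℝ) : ℂ) * f x).re
  rw [h2, ← div_eq_inv_mul, le_div_iff₀ hu, one_mul]
  exact this

-- The average `f₀` stands for all of `s`: a functional equal to 1 at `f₀` is 1 on `s`. Points are
-- added one at a time, each tested against the average of the images already supported.
open Classical in
theorem exists_support_finset (T : sphere (0 : E) 1 ≃ᵢ sphere (0 : X) 1)
    (s : Finset (sphere (0 : E) 1)) {ψ : StrongDual ℂ E} (hψ : ‖ψ‖ ≤ 1)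
    (h : ∀ f ∈ s, ψ f = 1) :
    ∃ φ : StrongDual ℂ X, ‖φ‖ ≤ 1 ∧ ∀ f ∈ s, φ (T f) = 1 := by
  rcases s.eq_empty_or_nonempty with rfl | hs
  · exact ⟨0, by simp, by simp⟩
  obtain ⟨f₀, -, hf₀⟩ := exists_average s hs (fun f => (f : E)) (fun f _ => (norm_eq_of_mem_sphere f).le)
    hψ h
  -- The norm of `T g + w` is the distance from `T g` to `-w`, which the isometry preserves. The
  -- value 2 at `f₀` gives a functional supporting `f₀` and `-T.symm (-w)`, hence all of `s`.
  have key : ∀ w : sphere (0 : X) 1, 2 ≤ ‖(T f₀ : X) + w‖ → ∀ f ∈ s, 2 ≤ ‖(T f : X) + w‖ := by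
    intro w hw f hf
    have hd : ∀ g, ‖(T g : X) + w‖ = ‖(g : E) + -(T.symm (-w) : E)‖ := by
      intro g
      have := T.dist_eq g (T.symm (-w))
      rw [T.apply_symm_apply, Subtype.dist_eq, Subtype.dist_eq, dist_eq_norm, dist_eq_norm] at this
      simpa [sub_eq_add_neg] using this
    rw [hd] at hw ⊢
    obtain ⟨χ, hχ, h1, h2⟩ := exists_support_of_two_le_norm_add (norm_eq_of_mem_sphere f₀).le
      (by rw [norm_neg]; exact (norm_eq_of_mem_sphere _).le) hw
    exact norm_add_eq_two_of_apply_eq_one hχ (hf₀ χ hχ h1 f hf) h2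
  suffices H : ∀ t : Finset (sphere (0 : E) 1), t ⊆ s →
      ∃ φ : StrongDual ℂ X, ‖φ‖ ≤ 1 ∧ ∀ f ∈ insert f₀ t, φ (T f) = 1 by
    obtain ⟨φ, hφ, hφs⟩ := H s subset_rfl
    exact ⟨φ, hφ, fun f hf => hφs f (Finset.mem_insert_of_mem hf)⟩
  intro t
  induction t using Finset.induction_on with
  | empty =>
    intro _
    obtain ⟨φ, hφ, h1⟩ := exists_dual_vector'' ℂ (T f₀ : X)
    refine ⟨φ, hφ, ?_⟩
    simpa using h1
  | insert f t hft ih =>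
    intro hts
    obtain ⟨φ, hφ, h1⟩ := ih (fun g hg => hts (Finset.mem_insert_of_mem hg))
    obtain ⟨w, hw, hwχ⟩ := exists_average (insert f₀ t) (Finset.insert_nonempty _ _)
      (fun f => (T f : X)) (fun f _ => (norm_eq_of_mem_sphere _).le) hφ h1
    have h2 := key w (norm_add_eq_two_of_apply_eq_one hφ (h1 f₀ (Finset.mem_insert_self _ _)) hw) f
      (hts (Finset.mem_insert_self _ _))
    obtain ⟨χ, hχ, hχf, hχw⟩ := exists_support_of_two_le_norm_add (norm_eq_of_mem_sphere _).le
      (norm_eq_of_mem_sphere _).le h2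
    have h3 := hwχ χ hχ hχw
    refine ⟨χ, hχ, fun g hg => ?_⟩
    rw [Finset.mem_insert, Finset.mem_insert] at hg
    rcases hg with rfl | rfl | hg
    · exact h3 _ (Finset.mem_insert_self _ _)
    · exact hχf
    · exact h3 _ (Finset.mem_insert_of_mem hg)

open Classical in
/-- A surjective isometry between unit spheres maps sets with a common supporting functional to
sets with a common supporting functional. -/
theorem exists_support_image (T : sphere (0 : E) 1 ≃ᵢ sphere (0 : X) 1)
    (C : Set (sphere (0 : E) 1)) {ψ : StrongDual ℂ E} (hψ : ‖ψ‖ ≤ 1) (h : ∀ f ∈ C, ψ f = 1) :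
    ∃ φ : StrongDual ℂ X, ‖φ‖ ≤ 1 ∧ ∀ f ∈ C, φ (T f) = 1 := by
  obtain ⟨φ, hφ, hφC⟩ := exists_support_of_convexHull (C := (fun f => (T f : X)) '' C)
    (by rintro _ ⟨f, -, rfl⟩; exact (norm_eq_of_mem_sphere _).le) (by
      intro x hx
      rw [convexHull_eq_union_convexHull_finite_subsets] at hx
      simp only [Set.mem_iUnion] at hx
      obtain ⟨t, ht, hx⟩ := hx
      obtain ⟨s, hsC, rfl⟩ := Finset.subset_set_image_iff.1 ht
      obtain ⟨φ, hφ, hφs⟩ := exists_support_finset T s hψ (fun f hf => h f (hsC hf))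
      have hconv : Convex ℝ {x : X | φ x = 1} := by
        intro x hx y hy a b _ _ hab
        have hx' : φ x = 1 := hx
        have hy' : φ y = 1 := hy
        change φ (a • x + b • y) = 1
        rw [map_add, φ.map_smul_of_tower, φ.map_smul_of_tower, hx', hy', ← add_smul, hab, one_smul]
      refine one_le_norm_of_apply_eq_one hφ (convexHull_min ?_ hconv hx)
      intro y hy
      obtain ⟨f, hf, rfl⟩ := Finset.mem_image.1 (Finset.mem_coe.1 hy)
      exact hφs f hf)
  exact ⟨φ, hφ, fun f hf => hφC _ ⟨f, hf, rfl⟩⟩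

theorem norm_smul_dual_le {φ : StrongDual ℂ X} (hφ : ‖φ‖ ≤ 1) {c : ℂ} (hc : ‖c‖ = 1) :
    ‖c • φ‖ ≤ 1 := by
  rwa [norm_smul, hc, one_mul]

theorem conj_mul_self_of_norm {c : ℂ} (hc : ‖c‖ = 1) : conj c * c = 1 := by
  rw [mul_comm, Complex.mul_conj, Complex.normSq_eq_norm_sq, hc]
  norm_num

end Support

/-! ### Faces of the sphere of C(K) and their images -/

section Faces

variable {K : Type*} [TopologicalSpace K] [CompactSpace K]
variable {X : Type*} [NormedAddCommGroup X] [NormedSpace ℂ X]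

/-- A function of modulus at most one that has modulus one at `p`, as a point of the sphere. -/
noncomputable def spherePoint (f : C(K, ℂ)) (p : K) (hf : ∀ t, ‖f t‖ ≤ 1) (hp : ‖f p‖ = 1) :
    sphere (0 : C(K, ℂ)) 1 :=
  ⟨f, by
    rw [mem_sphere_zero_iff_norm]
    exact le_antisymm ((ContinuousMap.norm_le _ zero_le_one).2 hf)
      (hp ▸ ContinuousMap.norm_coe_le_norm f p)⟩

theorem norm_apply_le_one_of_sphere (f : sphere (0 : C(K, ℂ)) 1) (t : K) :
    ‖(f : C(K, ℂ)) t‖ ≤ 1 :=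
  (ContinuousMap.norm_coe_le_norm _ t).trans (norm_eq_of_mem_sphere f).le

theorem exists_norm_apply_eq_one (p : K) (f : sphere (0 : C(K, ℂ)) 1) :
    ∃ q, ‖(f : C(K, ℂ)) q‖ = 1 := by
  obtain ⟨q, -, hq⟩ := isCompact_univ.exists_isMaxOn (s := (Set.univ : Set K)) ⟨p, trivial⟩
    (f : C(K, ℂ)).continuous.norm.continuousOn
  refine ⟨q, le_antisymm (norm_apply_le_one_of_sphere f q) ?_⟩
  refine (norm_eq_of_mem_sphere f).ge.trans ?_
  exact (ContinuousMap.norm_le _ (norm_nonneg _)).2 fun t => hq (Set.mem_univ t)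

/-- A set of functions in the unit sphere with a common supporting functional lies in a face. -/
theorem exists_forall_apply_eq (p : K) (C : Set (sphere (0 : C(K, ℂ)) 1))
    {ψ : StrongDual ℂ C(K, ℂ)} (hψ : ‖ψ‖ ≤ 1) (h : ∀ f ∈ C, ψ f = 1) :
    ∃ (q : K) (μ : ℂ), ‖μ‖ = 1 ∧ ∀ f ∈ C, (f : C(K, ℂ)) q = μ := by
  -- Compactness of K times the circle reduces to finite families. There the average attains modulus
  -- one at some `q`, and evaluation at `q`, suitably rotated, supports it and so every member.
  have hne := CompactSpace.iInter_nonempty (X := K × sphere (0 : ℂ) 1)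
    (t := fun f : C => {x | (f.1 : C(K, ℂ)) x.1 = x.2})
    (fun f => isClosed_eq ((f.1 : C(K, ℂ)).continuous.comp continuous_fst)
      (continuous_subtype_val.comp continuous_snd)) (by
      intro s
      rcases s.eq_empty_or_nonempty with rfl | hs
      · exact ⟨(p, ⟨1, by simp⟩), by simp⟩
      obtain ⟨w, -, hw⟩ := exists_average s hs (fun f => ((f : sphere (0 : C(K, ℂ)) 1) : C(K, ℂ)))
        (fun f _ => (norm_eq_of_mem_sphere _).le) hψ (fun f _ => h f f.2)
      obtain ⟨q, hq⟩ := exists_norm_apply_eq_one p w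
      set c := (w : C(K, ℂ)) q
      have hcc : conj c * c = 1 := conj_mul_self_of_norm hq
      refine ⟨(q, ⟨c, by simpa using hq⟩), ?_⟩
      simp only [Set.mem_iInter]
      intro f hf
      have hev : ∀ g : C(K, ℂ), (conj c • ContinuousMap.evalCLM ℂ q) g = conj c * g q :=
        fun g => rfl
      have hn : ‖conj c • (ContinuousMap.evalCLM ℂ q : StrongDual ℂ C(K, ℂ))‖ ≤ 1 := by
        refine ContinuousLinearMap.opNorm_le_bound _ zero_le_one fun g => ?_
        rw [hev, norm_mul, RCLike.norm_conj, hq]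
        gcongr
        exact ContinuousMap.norm_coe_le_norm g q
      have h1 := hw _ hn (by rw [hev, hcc]) f hf
      rw [hev] at h1
      have h2 := congrArg (c * ·) h1
      simp only [mul_one, ← mul_assoc] at h2
      rw [mul_comm c, hcc, one_mul] at h2
      exact h2)
  obtain ⟨⟨q, μ⟩, hx⟩ := hne
  rw [Set.mem_iInter] at hx
  exact ⟨q, μ, norm_eq_of_mem_sphere μ, fun f hf => hx ⟨f, hf⟩⟩

theorem exists_mem_face_face [T2Space K] {p q : K} (hpq : p ≠ q) {α β : ℂ} (hα : ‖α‖ = 1)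
    (hβ : ‖β‖ = 1) :
    ∃ f : sphere (0 : C(K, ℂ)) 1, (f : C(K, ℂ)) p = α ∧ (f : C(K, ℂ)) q = β := by
  obtain ⟨u, hu0, hu1, hu⟩ := exists_continuous_zero_one_of_isClosed
    (isClosed_singleton (x := p)) (isClosed_singleton (x := q)) (by simpa using hpq)
  have hp : u p = 0 := hu0 rfl
  have hq : u q = 1 := hu1 rfl
  refine ⟨spherePoint ⟨fun t => (1 - u t : ℝ) * α + (u t : ℝ) * β, by fun_prop⟩ p ?_ ?_, ?_, ?_⟩
  · intro t
    obtain ⟨h0, h1⟩ := hu t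
    refine (norm_add_le _ _).trans ?_
    rw [norm_mul, norm_mul, Complex.norm_real, Complex.norm_real, hα, hβ,
      Real.norm_of_nonneg h0, Real.norm_of_nonneg (by linarith)]
    linarith
  · simp [hp, hα]
  · simp [spherePoint, hp]
  · simp [spherePoint, hq]

/-- The constant function with value `μ`, as a point of the sphere. -/
noncomputable def constPoint (p : K) (μ : ℂ) (hμ : ‖μ‖ = 1) : sphere (0 : C(K, ℂ)) 1 :=
  spherePoint (ContinuousMap.const K μ) p (fun _ => hμ.le) hμ

theorem dist_constPoint_le (p : K) {μ ν : ℂ} (hμ : ‖μ‖ = 1) (hν : ‖ν‖ = 1) :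
    dist (constPoint p μ hμ) (constPoint p ν hν) ≤ ‖μ - ν‖ := by
  rw [Subtype.dist_eq, dist_eq_norm]
  exact (ContinuousMap.norm_le _ (norm_nonneg _)).2 fun t => le_rfl

theorem eq_of_face_subset [T2Space K] {p q : K} {α β : ℂ} (hα : ‖α‖ = 1)
    (hβ : ‖β‖ = 1) (h : ∀ f : sphere (0 : C(K, ℂ)) 1, (f : C(K, ℂ)) p = α → (f : C(K, ℂ)) q = β) :
    p = q ∧ α = β := by
  refine ⟨?_, h (constPoint p α hα) rfl⟩
  by_contra hpq
  obtain ⟨f, hf, hf'⟩ := exists_mem_face_face hpq hα (β := -β) (by simpa using hβ)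
  have := h f hf
  rw [hf', neg_eq_self] at this
  simp [this] at hβ

variable (T : sphere (0 : C(K, ℂ)) 1 ≃ᵢ sphere (0 : X) 1)

theorem exists_support_face (p : K) {α : ℂ} (hα : ‖α‖ = 1) :
    ∃ φ : StrongDual ℂ X, ‖φ‖ ≤ 1 ∧
      ∀ f : sphere (0 : C(K, ℂ)) 1, (f : C(K, ℂ)) p = α → φ (T f) = 1 := by
  refine exists_support_image T {f | (f : C(K, ℂ)) p = α}
    (ψ := conj α • (ContinuousMap.evalCLM ℂ p : StrongDual ℂ C(K, ℂ))) ?_ ?_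
  · refine norm_smul_dual_le ?_ (by simpa using hα)
    refine ContinuousLinearMap.opNorm_le_bound _ zero_le_one fun g => ?_
    rw [one_mul]
    exact ContinuousMap.norm_coe_le_norm g p
  · intro f hf
    change conj α * (f : C(K, ℂ)) p = 1
    rw [show (f : C(K, ℂ)) p = α from hf, conj_mul_self_of_norm hα]

theorem exists_face_of_support (p : K) {χ : StrongDual ℂ X} (hχ : ‖χ‖ ≤ 1) :
    ∃ (q : K) (μ : ℂ), ‖μ‖ = 1 ∧
      ∀ f : sphere (0 : C(K, ℂ)) 1, χ (T f) = 1 → (f : C(K, ℂ)) q = μ := by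
  obtain ⟨ψ, hψ, h⟩ := exists_support_image T.symm {x | χ x = 1} hχ (fun _ hx => hx)
  obtain ⟨q, μ, hμ, hq⟩ := exists_forall_apply_eq p {f | χ (T f) = 1} hψ (by
    intro f hf
    have := h (T f) hf
    rwa [T.symm_apply_apply] at this)
  exact ⟨q, μ, hμ, hq⟩

/-- Images of faces are maximal among the sets with a common supporting functional. -/
theorem apply_eq_of_support [T2Space K] {p : K} {α : ℂ} (hα : ‖α‖ = 1) {χ : StrongDual ℂ X}
    (hχ : ‖χ‖ ≤ 1)
    (h : ∀ f : sphere (0 : C(K, ℂ)) 1, (f : C(K, ℂ)) p = α → χ (T f) = 1)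
    (f : sphere (0 : C(K, ℂ)) 1) (hf : χ (T f) = 1) : (f : C(K, ℂ)) p = α := by
  -- Pulled back by `T`, the set supported by `χ` sits in a face and contains the face at `p`; one
  -- face inside another equals it.
  obtain ⟨q, μ, hμ, hq⟩ := exists_face_of_support T p hχ
  obtain ⟨rfl, rfl⟩ := eq_of_face_subset hα hμ (fun g hg => hq g (h g hg))
  exact hq f hf

theorem mem_supp_iff (p : K) (φ : StrongDual ℂ X) :
    φ ∈ supp T p 1 ↔ ‖φ‖ = 1 ∧
      ∀ f : sphere (0 : C(K, ℂ)) 1, φ (T f) = 1 ↔ (f : C(K, ℂ)) p = 1 := by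
  refine and_congr_right fun hφ => ?_
  constructor
  · intro h f
    constructor
    · intro hf
      have : (T f : X) ∈ φ ⁻¹' {1} ∩ closedBall (0 : X) 1 :=
        ⟨hf, sphere_subset_closedBall (T f).2⟩
      rw [h] at this
      obtain ⟨g, hg, hgf⟩ := this
      have : g = f := T.injective (Subtype.ext hgf)
      exact this ▸ hg
    · intro hf
      have : (T f : X) ∈ (fun f => (T f : X)) '' face p 1 := ⟨f, hf, rfl⟩
      rw [← h] at this
      exact this.1
  · intro h
    ext x
    constructor
    · rintro ⟨hx, hx1⟩
      have hx' : φ x = 1 := hx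
      have hxs : x ∈ sphere (0 : X) 1 := by
        rw [mem_sphere_zero_iff_norm]
        exact le_antisymm (mem_closedBall_zero_iff.1 hx1) (one_le_norm_of_apply_eq_one hφ.le hx')
      refine ⟨T.symm ⟨x, hxs⟩, ?_, by simp⟩
      exact (h _).1 (by rw [T.apply_symm_apply]; exact hx')
    · rintro ⟨f, hf, rfl⟩
      exact ⟨(h f).2 hf, sphere_subset_closedBall (T f).2⟩

theorem supp_nonempty [T2Space K] (p : K) : (supp T p 1).Nonempty := by
  obtain ⟨φ, hφ, h⟩ := exists_support_face T p (α := 1) (by simp)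
  have hφ1 : ‖φ‖ = 1 := by
    refine le_antisymm hφ ?_
    have h1 := h (constPoint p 1 (by simp)) rfl
    have := φ.le_opNorm (T (constPoint p 1 (by simp)))
    rwa [h1, norm_eq_of_mem_sphere, norm_one, mul_one] at this
  exact ⟨φ, (mem_supp_iff T p φ).2 ⟨hφ1, fun f =>
    ⟨apply_eq_of_support T (by simp) hφ h f, h f⟩⟩⟩

/-- The point `c • x` of the unit sphere, for `c` of modulus one. -/
def rotate (c : ℂ) (hc : ‖c‖ = 1) (x : sphere (0 : X) 1) : sphere (0 : X) 1 :=
  ⟨c • (x : X), by rw [mem_sphere_zero_iff_norm, norm_smul, hc, one_mul, norm_eq_of_mem_sphere]⟩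

variable {T}

/-- Rotation in X makes the γ-level set of φ the image of a face at some q. Were q ≠ p, a function
in both that face and A(p,1) would give φ the values γ and 1 at once. -/
theorem exists_apply_eq_iff [T2Space K] {p : K} {φ : StrongDual ℂ X} (hφ : φ ∈ supp T p 1)
    {γ : ℂ} (hγ : ‖γ‖ = 1) :
    ∃ μ : ℂ, ‖μ‖ = 1 ∧ ∀ f : sphere (0 : C(K, ℂ)) 1, φ (T f) = γ ↔ (f : C(K, ℂ)) p = μ := by
  rw [mem_supp_iff] at hφ
  obtain ⟨hφ1, hφ⟩ := hφ
  rcases eq_or_ne γ 1 with rfl | hne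
  · exact ⟨1, by simp, hφ⟩
  have hγ' : ‖conj γ‖ = 1 := by simpa using hγ
  have hγγ := conj_mul_self_of_norm hγ
  obtain ⟨q, μ, hμ, hq⟩ := exists_face_of_support T p (norm_smul_dual_le hφ1.le hγ')
  obtain ⟨χ, hχ, hχq⟩ := exists_support_face T q hμ
  have hrot : ∀ (c : ℂ) (hc : ‖c‖ = 1) f, (T (T.symm (rotate c hc (T f))) : X) = c • (T f : X) := by
    intro c hc f
    rw [T.apply_symm_apply]
    rfl
  have hmax := apply_eq_of_support T (p := p) (α := 1) (by simp) (norm_smul_dual_le hχ hγ) (by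
    intro f hf
    have h1 := hχq (T.symm (rotate γ hγ (T f))) (hq _ (by
      rw [hrot]
      change conj γ * φ (γ • (T f : X)) = 1
      rw [map_smul, (hφ f).2 hf, smul_eq_mul, mul_one, hγγ]))
    rw [hrot, map_smul] at h1
    exact h1)
  have hiff : ∀ f : sphere (0 : C(K, ℂ)) 1, φ (T f) = γ ↔ (f : C(K, ℂ)) q = μ := by
    intro f
    constructor
    · intro hf
      refine hq f ?_
      change conj γ * φ (T f) = 1
      rw [hf, hγγ]
    · intro hf
      have h1 := hmax (T.symm (rotate (conj γ) hγ' (T f))) (by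
        rw [hrot]
        change γ * χ (conj γ • (T f : X)) = 1
        rw [map_smul, hχq f hf, smul_eq_mul, mul_one, mul_comm, hγγ])
      have h2 := (hφ _).2 h1
      rw [hrot, map_smul, smul_eq_mul] at h2
      have h3 := congrArg (γ * ·) h2
      simp only [mul_one, ← mul_assoc] at h3
      rwa [mul_comm γ, hγγ, one_mul] at h3
  have hpq : p = q := by
    by_contra hpq
    obtain ⟨f, hfp, hfq⟩ := exists_mem_face_face hpq (α := 1) (by simp) hμ
    exact hne (((hiff f).2 hfq).symm.trans ((hφ f).2 hfp))
  subst hpq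
  exact ⟨μ, hμ, hiff⟩

theorem exists_circle_map [T2Space K] {p : K} {φ : StrongDual ℂ X} (hφ : φ ∈ supp T p 1) :
    ∃ τ : ℂ → ℂ, (∀ γ, ‖γ‖ = 1 → ‖τ γ‖ = 1) ∧ τ 1 = 1 ∧
      (∀ γ, ‖γ‖ = 1 → ∀ f : sphere (0 : C(K, ℂ)) 1, φ (T f) = γ ↔ (f : C(K, ℂ)) p = τ γ) ∧
      ∀ γ δ, ‖γ‖ = 1 → ‖δ‖ = 1 → ‖τ γ - τ δ‖ = ‖γ - δ‖ := by
  have hex : ∀ γ : ℂ, ∃ μ : ℂ, ‖γ‖ = 1 → ‖μ‖ = 1 ∧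
      ∀ f : sphere (0 : C(K, ℂ)) 1, φ (T f) = γ ↔ (f : C(K, ℂ)) p = μ := by
    intro γ
    by_cases hγ : ‖γ‖ = 1
    · obtain ⟨μ, h⟩ := exists_apply_eq_iff hφ hγ
      exact ⟨μ, fun _ => h⟩
    · exact ⟨0, fun h => absurd h hγ⟩
  choose τ hτ using hex
  have hφ' := (mem_supp_iff T p φ).1 hφ
  have hone : φ (T (constPoint p 1 (by simp))) = 1 := (hφ'.2 _).2 rfl
  refine ⟨τ, fun γ hγ => (hτ γ hγ).1, (((hτ 1 (by simp)).2 _).1 hone).symm,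
    fun γ hγ => (hτ γ hγ).2, fun γ δ hγ hδ => le_antisymm ?_ ?_⟩
  -- Preimages of the rotations of `x` realise the values of `τ` at `p`, and evaluation is
  -- 1-Lipschitz.
  · set x := T (constPoint p 1 (by simp))
    have hr : ∀ c (hc : ‖c‖ = 1), (T.symm (rotate c hc x) : C(K, ℂ)) p = τ c := by
      intro c hc
      refine ((hτ c hc).2 _).1 ?_
      rw [T.apply_symm_apply]
      change φ (c • (x : X)) = c
      rw [map_smul, hone, smul_eq_mul, mul_one]
    rw [← hr γ hγ, ← hr δ hδ]
    refine (ContinuousMap.norm_coe_le_norm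
      ((T.symm (rotate γ hγ x) : C(K, ℂ)) - (T.symm (rotate δ hδ x) : C(K, ℂ))) p).trans ?_
    rw [← dist_eq_norm, ← Subtype.dist_eq, T.symm.dist_eq, Subtype.dist_eq, dist_eq_norm]
    change ‖γ • (x : X) - δ • (x : X)‖ ≤ _
    rw [← sub_smul, norm_smul, norm_eq_of_mem_sphere, mul_one]
  -- Conversely, constant functions realise the values of `τ`, and `φ` is 1-Lipschitz.
  · have hc : ∀ c (hc : ‖c‖ = 1), φ (T (constPoint p (τ c) (hτ c hc).1)) = c :=
      fun c hc => ((hτ c hc).2 _).2 rfl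
    refine le_trans ?_ (dist_constPoint_le p (hτ γ hγ).1 (hτ δ hδ).1)
    rw [← T.dist_eq, Subtype.dist_eq, dist_eq_norm]
    have := φ.le_of_opNorm_le hφ'.1.le ((T (constPoint p (τ γ) (hτ γ hγ).1) : X) -
      T (constPoint p (τ δ) (hτ δ hδ).1))
    rwa [map_sub, hc γ hγ, hc δ hδ, one_mul] at this

theorem re_eq_of_norm_sub_one {z w : ℂ} (hz : ‖z‖ = 1) (hw : ‖w‖ = 1)
    (h : ‖z - 1‖ = ‖w - 1‖) : z.re = w.re := by
  have h1 := congrArg (· ^ 2) h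
  have hz2 := congrArg (· ^ 2) hz
  have hw2 := congrArg (· ^ 2) hw
  simp only [Complex.sq_norm, Complex.normSq_apply, Complex.sub_re, Complex.sub_im, Complex.one_re,
    Complex.one_im] at h1 hz2 hw2
  linarith

/-- An isometry of the unit circle that fixes `1` is the identity or the conjugation. -/
theorem circle_map_eq {τ : ℂ → ℂ} (hn : ∀ γ, ‖γ‖ = 1 → ‖τ γ‖ = 1) (h1 : τ 1 = 1)
    (h : ∀ γ δ, ‖γ‖ = 1 → ‖δ‖ = 1 → ‖τ γ - τ δ‖ = ‖γ - δ‖) :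
    (∀ γ, ‖γ‖ = 1 → τ γ = γ) ∨ (∀ γ, ‖γ‖ = 1 → τ γ = conj γ) := by
  have hre : ∀ γ, ‖γ‖ = 1 → (τ γ).re = γ.re := fun γ hγ =>
    re_eq_of_norm_sub_one (hn γ hγ) hγ (by have := h γ 1 hγ (by simp); rwa [h1] at this)
  have hI := hre Complex.I (by simp)
  have hnI := hn Complex.I (by simp)
  have hsq : ∀ z : ℂ, ‖z‖ = 1 → z.re * z.re + z.im * z.im = 1 := by
    intro z hz
    rw [← Complex.normSq_apply, Complex.normSq_eq_norm_sq, hz, one_pow]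
  have him : (τ Complex.I).im = 1 ∨ (τ Complex.I).im = -1 := by
    have := hsq _ hnI
    rw [hI, Complex.I_re] at this
    exact mul_self_eq_one_iff.1 (by linarith)
  have hmul : ∀ γ, ‖γ‖ = 1 → (τ γ).im * (τ Complex.I).im = γ.im := by
    intro γ hγ
    have h2 := congrArg (· ^ 2) (h γ Complex.I hγ (by simp))
    have h3 := hsq _ hγ
    have h4 := hsq _ (hn γ hγ)
    have h5 := hsq _ hnI
    simp only [Complex.sq_norm, Complex.normSq_apply, Complex.sub_re, Complex.sub_im, hI,
      Complex.I_re, Complex.I_im] at h2 h5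
    linarith
  refine him.imp (fun h2 γ hγ => Complex.ext (hre γ hγ) ?_)
    (fun h2 γ hγ => Complex.ext (hre γ hγ) ?_)
  · simpa [h2] using hmul γ hγ
  · have := hmul γ hγ
    rw [h2] at this
    rw [Complex.conj_im]
    linarith

/-- The two discs have radii summing to 2, the distance between their centres, so they can meet only
at the point of tangency. -/
theorem eq_mul_of_norm_sub_le {z ν : ℂ} {r : ℝ} (hν : ‖ν‖ = 1)
    (h1 : ‖ν - z‖ ≤ 1 - r) (h2 : ‖-ν - z‖ ≤ 1 + r) : z = r * ν := by
  have key : ∀ w : ℂ, ‖1 - w‖ ≤ 1 - r → ‖-1 - w‖ ≤ 1 + r → w = r := by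
    intro w h1 h2
    have h3 := (Complex.re_le_norm _).trans h1
    have h4 := (neg_le_abs _).trans ((Complex.abs_re_le_norm _).trans h2)
    simp only [Complex.sub_re, Complex.neg_re, Complex.one_re] at h3 h4
    have hre : w.re = r := by linarith
    have h5 : ‖1 - w‖ ^ 2 ≤ (1 - r) ^ 2 := pow_le_pow_left₀ (norm_nonneg _) h1 2
    rw [Complex.sq_norm, Complex.normSq_apply] at h5
    simp only [Complex.sub_re, Complex.sub_im, Complex.one_re, Complex.one_im, hre] at h5
    have him : w.im = 0 := by nlinarith [sq_nonneg w.im]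
    exact Complex.ext (by simpa using hre) (by simpa using him)
  have hνν := conj_mul_self_of_norm hν
  have hn : ∀ u : ℂ, ‖conj ν * u‖ = ‖u‖ := fun u => by
    rw [norm_mul, RCLike.norm_conj, hν, one_mul]
  have := key (conj ν * z) (by rw [← hνν, ← mul_sub, hn]; exact h1)
    (by rw [← hνν, ← mul_neg, ← mul_sub, hn]; exact h2)
  rw [← this, mul_comm, ← mul_assoc, mul_comm ν, hνν, one_mul]

/-- A function of the sphere with value `r * μ` at `p`, where `‖μ‖ = 1` and `0 ≤ r`, is at
distance at most `1 - r` from a function of the sphere with value `μ` at `p`. -/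
theorem exists_dist_le_one_sub {p : K} {μ : ℂ} (hμ : ‖μ‖ = 1) {r : ℝ} (hr : 0 ≤ r)
    (f : sphere (0 : C(K, ℂ)) 1) (hf : (f : C(K, ℂ)) p = r * μ) :
    ∃ g : sphere (0 : C(K, ℂ)) 1, (g : C(K, ℂ)) p = μ ∧ dist g f ≤ 1 - r := by
  have hfp : ‖(f : C(K, ℂ)) p‖ = r := by
    rw [hf, norm_mul, hμ, mul_one, Complex.norm_real, Real.norm_of_nonneg hr]
  have hf1 := norm_apply_le_one_of_sphere f
  have hr1 : r ≤ 1 := hfp ▸ hf1 p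
  -- The minimum keeps both the displacement below `1 - r` and the modulus below 1; the two bounds
  -- agree at `p`.
  let g : C(K, ℂ) := ⟨fun t => (f : C(K, ℂ)) t +
    ((min (1 - r) (1 - ‖(f : C(K, ℂ)) t‖) : ℝ) : ℂ) * μ, by fun_prop⟩
  have hg : ∀ t, g t = (f : C(K, ℂ)) t +
    ((min (1 - r) (1 - ‖(f : C(K, ℂ)) t‖) : ℝ) : ℂ) * μ := fun _ => rfl
  have hn : ∀ t, ‖((min (1 - r) (1 - ‖(f : C(K, ℂ)) t‖) : ℝ) : ℂ) * μ‖ =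
      min (1 - r) (1 - ‖(f : C(K, ℂ)) t‖) := by
    intro t
    rw [norm_mul, hμ, mul_one, Complex.norm_real, Real.norm_of_nonneg]
    exact le_min (by linarith) (by linarith [hf1 t])
  have hgp : g p = μ := by
    rw [hg, hfp, min_self, hf, Complex.ofReal_sub, Complex.ofReal_one]
    ring
  refine ⟨spherePoint g p ?_ (by rw [hgp, hμ]), hgp, ?_⟩
  · intro t
    rw [hg]
    refine (norm_add_le _ _).trans ?_
    rw [hn]
    linarith [min_le_right (1 - r) (1 - ‖(f : C(K, ℂ)) t‖)]
  · rw [Subtype.dist_eq, dist_eq_norm]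
    refine (ContinuousMap.norm_le _ (by linarith)).2 fun t => ?_
    change ‖g t - (f : C(K, ℂ)) t‖ ≤ _
    rw [hg, add_sub_cancel_left, hn]
    exact min_le_left _ _

/-- A function of the sphere with value `r * μ` at `p`, where `‖μ‖ = 1` and `0 ≤ r`, is at
distance at most `1 + r` from a function of the sphere with value `-μ` at `p`. -/
theorem exists_dist_le_one_add {p : K} {μ : ℂ} (hμ : ‖μ‖ = 1) {r : ℝ} (hr : 0 ≤ r)
    (f : sphere (0 : C(K, ℂ)) 1) (hf : (f : C(K, ℂ)) p = r * μ) :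
    ∃ g : sphere (0 : C(K, ℂ)) 1, (g : C(K, ℂ)) p = -μ ∧ dist g f ≤ 1 + r := by
  have hfp : ‖(f : C(K, ℂ)) p‖ = r := by
    rw [hf, norm_mul, hμ, mul_one, Complex.norm_real, Real.norm_of_nonneg hr]
  have hf1 := norm_apply_le_one_of_sphere f
  let g : C(K, ℂ) := ⟨fun t =>
    -(((min 1 (1 + r - ‖(f : C(K, ℂ)) t‖) : ℝ) : ℂ) * μ), by fun_prop⟩
  have hg : ∀ t, g t = -(((min 1 (1 + r - ‖(f : C(K, ℂ)) t‖) : ℝ) : ℂ) * μ) := fun _ => rfl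
  have hn : ∀ t, ‖g t‖ = min 1 (1 + r - ‖(f : C(K, ℂ)) t‖) := by
    intro t
    rw [hg, norm_neg, norm_mul, hμ, mul_one, Complex.norm_real, Real.norm_of_nonneg]
    exact le_min (by linarith) (by linarith [hf1 t])
  have hgp : g p = -μ := by
    rw [hg, hfp, add_sub_cancel_right, min_self, Complex.ofReal_one, one_mul]
  refine ⟨spherePoint g p ?_ (by rw [hgp, norm_neg, hμ]), hgp, ?_⟩
  · intro t
    rw [hn]
    exact min_le_left _ _
  · rw [Subtype.dist_eq, dist_eq_norm]
    refine (ContinuousMap.norm_le _ (by linarith)).2 fun t => ?_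
    refine (norm_sub_le (g t) ((f : C(K, ℂ)) t)).trans ?_
    rw [hn]
    linarith [min_le_right 1 (1 + r - ‖(f : C(K, ℂ)) t‖)]

/-- `σ` is the identity or conjugation. Nearby functions in the faces with values `μ` and `-μ`
confine `φ (T f)` to two tangent discs. -/
theorem apply_eq_of_face {p : K} {φ : StrongDual ℂ X} (hφ : ‖φ‖ ≤ 1) (σ : ℂ →+* ℂ)
    (hσn : ∀ z, ‖σ z‖ = ‖z‖) (hσr : ∀ r : ℝ, σ r = r)
    (h : ∀ f : sphere (0 : C(K, ℂ)) 1, ‖(f : C(K, ℂ)) p‖ = 1 → φ (T f) = σ ((f : C(K, ℂ)) p))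
    (f : sphere (0 : C(K, ℂ)) 1) : φ (T f) = σ ((f : C(K, ℂ)) p) := by
  obtain ⟨r, hr, μ, hμ, hf⟩ : ∃ r : ℝ, 0 ≤ r ∧ ∃ μ : ℂ, ‖μ‖ = 1 ∧ (f : C(K, ℂ)) p = r * μ := by
    refine ⟨‖(f : C(K, ℂ)) p‖, norm_nonneg _, ?_⟩
    by_cases h0 : (f : C(K, ℂ)) p = 0
    · exact ⟨1, by simp, by simp [h0]⟩
    · refine ⟨(f : C(K, ℂ)) p / ‖(f : C(K, ℂ)) p‖, by simp [h0], ?_⟩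
      rw [mul_div_cancel₀]
      simpa using h0
  have hd : ∀ g, ‖φ (T g) - φ (T f)‖ ≤ dist g f := by
    intro g
    rw [← map_sub, ← T.dist_eq, Subtype.dist_eq, dist_eq_norm]
    simpa using φ.le_of_opNorm_le hφ ((T g : X) - T f)
  obtain ⟨g, hgp, hg⟩ := exists_dist_le_one_sub hμ hr f hf
  obtain ⟨g', hgp', hg'⟩ := exists_dist_le_one_add hμ hr f hf
  have h1 := (hd g).trans hg
  have h2 := (hd g').trans hg'
  rw [h g (by rw [hgp, hμ]), hgp] at h1
  rw [h g' (by rw [hgp', norm_neg, hμ]), hgp', map_neg] at h2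
  rw [eq_mul_of_norm_sub_le ((hσn μ).trans hμ) h1 h2, hf, map_mul, hσr]

/-- Evaluation of a supporting functional along the isometry is evaluation at the point, or its
complex conjugate. -/
theorem apply_eq_or_conj [T2Space K] {p : K} {φ : StrongDual ℂ X} (hφ : φ ∈ supp T p 1) :
    (∀ f : sphere (0 : C(K, ℂ)) 1, φ (T f) = (f : C(K, ℂ)) p) ∨
      ∀ f : sphere (0 : C(K, ℂ)) 1, φ (T f) = conj ((f : C(K, ℂ)) p) := by
  obtain ⟨τ, hn, h1, hiff, hτ⟩ := exists_circle_map hφ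
  refine (circle_map_eq hn h1 hτ).imp (fun h => ?_) (fun h => ?_)
  · refine apply_eq_of_face hφ.1.le (RingHom.id ℂ) (fun _ => rfl) (fun _ => rfl) fun f hf => ?_
    exact (hiff _ hf f).2 (h _ hf).symm
  · refine apply_eq_of_face hφ.1.le (starRingEnd ℂ) (fun z => RCLike.norm_conj z)
      Complex.conj_ofReal fun f hf => ?_
    have hf' : ‖conj ((f : C(K, ℂ)) p)‖ = 1 := by rwa [RCLike.norm_conj]
    exact (hiff _ hf' f).2 (by rw [h _ hf', Complex.conj_conj])

end Faces

/-! ### The clopen set and the real linear extension -/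

section Extension

variable {K : Type*} [TopologicalSpace K]

theorem sigma_of_mem {K₁ : Clopens K} {p : K} (hp : p ∈ K₁) (a : C(K, ℂ)) :
    sigma K₁ p a = a p := if_pos hp

theorem sigma_of_notMem {K₁ : Clopens K} {p : K} (hp : p ∉ K₁) (a : C(K, ℂ)) :
    sigma K₁ p a = conj (a p) := if_neg hp

theorem chi_of_mem {U : Clopens K} {p : K} (hp : p ∈ U) : chi U p = 1 := by
  have hp' : p ∈ (U : Set K) := hp
  simp [chi, LocallyConstant.charFn, hp']

theorem chi_of_notMem {U : Clopens K} {p : K} (hp : p ∉ U) : chi U p = 0 := by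
  have hp' : p ∉ (U : Set K) := hp
  simp [chi, LocallyConstant.charFn, hp']

theorem norm_chi_le (U : Clopens K) (p : K) : ‖chi U p‖ ≤ 1 := by
  by_cases hp : p ∈ U
  · simp [chi_of_mem hp]
  · simp [chi_of_notMem hp]

variable [CompactSpace K]
variable {X : Type*} [NormedAddCommGroup X] [NormedSpace ℂ X]

theorem I_ne_conj_I : Complex.I ≠ conj Complex.I := by
  intro h
  have := congrArg Complex.im h
  norm_num at this

variable (T : sphere (0 : C(K, ℂ)) 1 ≃ᵢ sphere (0 : X) 1)

theorem exists_clopens_apply_eq_sigma [T2Space K] :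
    ∃ K₁ : Clopens K, ∀ p, ∀ φ ∈ supp T p 1, ∀ a : sphere (0 : C(K, ℂ)) 1,
      φ (T a) = sigma K₁ p a := by
  rcases isEmpty_or_nonempty K with hK | ⟨⟨p₀⟩⟩
  · exact ⟨⊥, fun p => hK.elim p⟩
  set u := constPoint p₀ 1 (by simp)
  -- Each supporting functional equals i at `T g`, so `g p` is i where it acts linearly and -i where
  -- it acts conjugate-linearly.
  set g := T.symm (rotate Complex.I (by simp) (T u))
  have hg : ∀ p, ∀ φ ∈ supp T p 1, φ (T g) = Complex.I := by
    intro p φ hφ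
    rw [T.apply_symm_apply]
    change φ (Complex.I • (T u : X)) = Complex.I
    rw [map_smul, (((mem_supp_iff T p φ).1 hφ).2 u).2 rfl, smul_eq_mul, mul_one]
  have hor : ∀ p, (g : C(K, ℂ)) p = Complex.I ∨ (g : C(K, ℂ)) p = conj Complex.I := by
    intro p
    obtain ⟨φ, hφ⟩ := supp_nonempty T p
    refine (apply_eq_or_conj hφ).imp (fun h => ?_) (fun h => ?_)
    · rw [← h, hg p φ hφ]
    · rw [← hg p φ hφ, h, Complex.conj_conj]
  have hcl : ∀ c, IsClosed {p | (g : C(K, ℂ)) p = c} := fun c =>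
    isClosed_eq (g : C(K, ℂ)).continuous continuous_const
  have hcompl : {p | (g : C(K, ℂ)) p = Complex.I} = {p | (g : C(K, ℂ)) p = conj Complex.I}ᶜ := by
    ext p
    refine ⟨fun h h' => I_ne_conj_I (h.symm.trans h'), fun h => (hor p).resolve_right h⟩
  refine ⟨⟨{p | (g : C(K, ℂ)) p = Complex.I}, hcl _, hcompl ▸ (hcl _).isOpen_compl⟩, ?_⟩
  intro p φ hφ a
  have hφg := hg p φ hφ
  rcases hor p with hp | hp
  · rw [sigma_of_mem (by exact hp)]
    rcases apply_eq_or_conj hφ with h | h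
    · exact h a
    · rw [h, hp] at hφg
      exact absurd hφg.symm I_ne_conj_I
  · rw [sigma_of_notMem (by exact fun h => I_ne_conj_I (Eq.trans (Eq.symm h) hp))]
    rcases apply_eq_or_conj hφ with h | h
    · rw [h, hp] at hφg
      exact absurd hφg.symm I_ne_conj_I
    · exact h a

theorem exists_smul_sphere {E : Type*} [NormedAddCommGroup E] [NormedSpace ℝ E] {x : E}
    (hx : x ≠ 0) : ∃ y : sphere (0 : E) 1, x = ‖x‖ • (y : E) := by
  have hx' : ‖x‖ ≠ 0 := norm_ne_zero_iff.2 hx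
  refine ⟨⟨‖x‖⁻¹ • x, ?_⟩, ?_⟩
  · rw [mem_sphere_zero_iff_norm, norm_smul, norm_inv, norm_norm, inv_mul_cancel₀ hx']
  · rw [smul_smul, mul_inv_cancel₀ hx', one_smul]

variable {T}

-- The pointwise formula is real linear in x. Scaling from the sphere, where it returns the preimage
-- under `T`, supplies both continuity in p and preservation of norm.
open Classical in
theorem exists_coordinates [T2Space K] {K₁ : Clopens K}
    (hK₁ : ∀ p, ∀ φ ∈ supp T p 1, ∀ a : sphere (0 : C(K, ℂ)) 1, φ (T a) = sigma K₁ p a) :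
    ∃ V : X ≃ₗᵢ[ℝ] C(K, ℂ), (∀ a, V (T a) = a) ∧ ∃ φ : K → StrongDual ℂ X,
      (∀ p, φ p ∈ supp T p 1) ∧ ∀ x p, V x p = if p ∈ K₁ then φ p x else conj (φ p x) := by
  choose φ hφ using fun p => supp_nonempty T p
  have hT : ∀ (a : sphere (0 : C(K, ℂ)) 1) p,
      (a : C(K, ℂ)) p = if p ∈ K₁ then φ p (T a) else conj (φ p (T a)) := by
    intro a p
    rw [hK₁ p _ (hφ p)]
    split_ifs with hp
    · rw [sigma_of_mem hp]
    · rw [sigma_of_notMem hp, Complex.conj_conj]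
  have hsmul : ∀ (r : ℝ) (x : X) p, (if p ∈ K₁ then φ p (r • x) else conj (φ p (r • x))) =
      (r : ℂ) * if p ∈ K₁ then φ p x else conj (φ p x) := by
    intro r x p
    rw [(φ p).map_smul_of_tower, Complex.real_smul, map_mul, Complex.conj_ofReal, mul_ite]
  have hex : ∀ x : X, ∃ a : C(K, ℂ), ‖a‖ = ‖x‖ ∧
      ∀ p, a p = if p ∈ K₁ then φ p x else conj (φ p x) := by
    intro x
    rcases eq_or_ne x 0 with rfl | hx
    · exact ⟨0, by simp, by simp⟩
    obtain ⟨y, hy⟩ := exists_smul_sphere hx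
    refine ⟨‖x‖ • (T.symm y : C(K, ℂ)), ?_, fun p => ?_⟩
    · rw [norm_smul, norm_norm, norm_eq_of_mem_sphere, mul_one]
    · conv_rhs => rw [hy]
      rw [hsmul, ContinuousMap.smul_apply, hT, T.apply_symm_apply, Complex.real_smul]
  choose V hVn hV using hex
  let L : X →ₗᵢ[ℝ] C(K, ℂ) :=
    { toFun := V
      map_add' := fun x y => by
        ext p
        rw [ContinuousMap.add_apply, hV, hV, hV]
        split_ifs <;> simp
      map_smul' := fun r x => by
        ext p
        rw [RingHom.id_apply, ContinuousMap.smul_apply, hV, hV, hsmul, Complex.real_smul]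
      norm_map' := hVn }
  have hL : ∀ x p, L x p = if p ∈ K₁ then φ p x else conj (φ p x) := hV
  have hLT : ∀ a, L (T a) = a := fun a => ContinuousMap.ext fun p => by rw [hL, ← hT]
  have hsurj : Function.Surjective L := by
    intro b
    rcases eq_or_ne b 0 with rfl | hb
    · exact ⟨0, map_zero L⟩
    obtain ⟨c, hc⟩ := exists_smul_sphere hb
    refine ⟨‖b‖ • (T c : X), ?_⟩
    rw [map_smul, hLT, ← hc]
  exact ⟨LinearIsometryEquiv.ofSurjective L hsurj, hLT, φ, hφ, hL⟩

theorem eq_of_forall_supp [T2Space K] {K₁ : Clopens K}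
    (hK₁ : ∀ p, ∀ φ ∈ supp T p 1, ∀ a : sphere (0 : C(K, ℂ)) 1, φ (T a) = sigma K₁ p a)
    {x y : X} (h : ∀ p, ∀ φ ∈ supp T p 1, φ x = φ y) : x = y := by
  obtain ⟨V, -, φ, hφ, hV⟩ := exists_coordinates hK₁
  refine V.injective (ContinuousMap.ext fun p => ?_)
  rw [hV, hV, h p _ (hφ p)]

theorem isLinearPart_of_apply_eq_sigma [T2Space K] {K₁ : Clopens K}
    (hK₁ : ∀ p, ∀ φ ∈ supp T p 1, ∀ a : sphere (0 : C(K, ℂ)) 1, φ (T a) = sigma K₁ p a) :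
    IsLinearPart T K₁ where
  linear γ _ e f he hf := by
    refine eq_of_forall_supp hK₁ fun p φ hφ => ?_
    rw [map_smul, hK₁ p φ hφ, hK₁ p φ hφ, he, hf, smul_eq_mul]
    by_cases hp : p ∈ K₁
    · rw [sigma_of_mem hp, sigma_of_mem hp, ContinuousMap.smul_apply, smul_eq_mul]
    · rw [sigma_of_notMem hp, sigma_of_notMem hp, ContinuousMap.smul_apply, chi_of_notMem hp]
      simp
  conjLinear γ _ e f he hf := by
    refine eq_of_forall_supp hK₁ fun p φ hφ => ?_
    rw [map_smul, hK₁ p φ hφ, hK₁ p φ hφ, he, hf, smul_eq_mul]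
    by_cases hp : p ∈ K₁
    · have hp' : p ∉ K₁ᶜ := fun h => h hp
      rw [sigma_of_mem hp, sigma_of_mem hp, ContinuousMap.smul_apply, chi_of_notMem hp']
      simp
    · rw [sigma_of_notMem hp, sigma_of_notMem hp, ContinuousMap.smul_apply, smul_eq_mul, map_mul]

/-- At a point where `U` and `K₁` differ, testing with γ = i would give i equal to its conjugate. -/
theorem eq_of_isLinearPart [T2Space K] {K₁ U : Clopens K}
    (hK₁ : ∀ p, ∀ φ ∈ supp T p 1, ∀ a : sphere (0 : C(K, ℂ)) 1, φ (T a) = sigma K₁ p a)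
    (hU : IsLinearPart T U) : U = K₁ := by
  have hI : ‖Complex.I‖ = 1 := by simp
  ext p
  obtain ⟨φ, hφ⟩ := supp_nonempty T p
  have hpt : ∀ W : Clopens K, p ∈ W → ∀ γ : ℂ, ‖γ‖ = 1 →
      ∃ f : sphere (0 : C(K, ℂ)) 1, (f : C(K, ℂ)) = γ • chi W := by
    intro W hp γ hγ
    refine ⟨spherePoint (γ • chi W) p (fun t => ?_) ?_, rfl⟩
    · rw [ContinuousMap.smul_apply, norm_smul, hγ, one_mul]
      exact norm_chi_le W t
    · rw [ContinuousMap.smul_apply, norm_smul, hγ, chi_of_mem hp, norm_one, mul_one]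
  by_cases hp : p ∈ U
  · refine iff_of_true hp ?_
    by_contra hp₁
    obtain ⟨e, he⟩ := hpt U hp 1 (by simp)
    obtain ⟨f, hf⟩ := hpt U hp Complex.I hI
    have h := congrArg φ (hU.linear Complex.I hI e f (by rw [he, one_smul]) hf)
    rw [map_smul, hK₁ p φ hφ, hK₁ p φ hφ, sigma_of_notMem hp₁, sigma_of_notMem hp₁, he, hf,
      ContinuousMap.smul_apply, ContinuousMap.smul_apply, chi_of_mem hp] at h
    refine I_ne_conj_I ?_
    simpa using h.symm
  · refine iff_of_false hp fun hp₁ => ?_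
    have hp' : p ∈ Uᶜ := hp
    have hp₁' : p ∈ K₁ := hp₁
    obtain ⟨e, he⟩ := hpt Uᶜ hp' 1 (by simp)
    obtain ⟨f, hf⟩ := hpt Uᶜ hp' Complex.I hI
    have h := congrArg φ (hU.conjLinear Complex.I hI e f (by rw [he, one_smul]) hf)
    rw [map_smul, hK₁ p φ hφ, hK₁ p φ hφ, sigma_of_mem hp₁', sigma_of_mem hp₁', he, hf,
      ContinuousMap.smul_apply, ContinuousMap.smul_apply, chi_of_mem hp'] at h
    refine I_ne_conj_I ?_
    simpa using h

end Extension

end TingleyCK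

theorem propositionp {K : Type*} [TopologicalSpace K] [CompactSpace K] [T2Space K]
    [ExtremallyDisconnected K]
    {X : Type*} [NormedAddCommGroup X] [NormedSpace ℂ X] [CompleteSpace X]
    (Δ : Metric.sphere (0 : C(K, ℂ)) 1 → Metric.sphere (0 : X) 1)
    (hΔ : Isometry Δ) (hΔsurj : Function.Surjective Δ) :
    (∃! K₁ : TopologicalSpace.Clopens K, TingleyCK.IsLinearPart Δ K₁) ∧
    (∀ K₁ : TopologicalSpace.Clopens K, TingleyCK.IsLinearPart Δ K₁ →
      ∀ t₀ : K, (TingleyCK.supp Δ t₀ 1).Nonempty ∧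
        ∀ φ ∈ TingleyCK.supp Δ t₀ 1, ∀ a : Metric.sphere (0 : C(K, ℂ)) 1,
          φ (Δ a : X) = TingleyCK.sigma K₁ t₀ a) ∧
    (∃ T : C(K, ℂ) ≃ₗᵢ[ℝ] X,
      ∀ a : Metric.sphere (0 : C(K, ℂ)) 1, T (a : C(K, ℂ)) = (Δ a : X)) := by
  let T : Metric.sphere (0 : C(K, ℂ)) 1 ≃ᵢ Metric.sphere (0 : X) 1 :=
    ⟨Equiv.ofBijective Δ ⟨hΔ.injective, hΔsurj⟩, hΔ⟩
  obtain ⟨K₁, hK₁⟩ := TingleyCK.exists_clopens_apply_eq_sigma T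
  have huniq : ∀ U : TopologicalSpace.Clopens K, TingleyCK.IsLinearPart Δ U → U = K₁ :=
    fun _ hU => TingleyCK.eq_of_isLinearPart (T := T) hK₁ hU
  refine ⟨⟨K₁, TingleyCK.isLinearPart_of_apply_eq_sigma (T := T) hK₁, huniq⟩, ?_, ?_⟩
  · intro U hU t₀
    obtain rfl := huniq U hU
    exact ⟨TingleyCK.supp_nonempty T t₀, hK₁ t₀⟩
  · obtain ⟨V, hV, -⟩ := TingleyCK.exists_coordinates hK₁
    exact ⟨V.symm, fun a => V.symm_apply_eq.2 (hV a).symm⟩
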